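/- Let $p$ be a prime with $p \equiv 1 \pmod 3$, let $F$ be a finite field of characteristic $p$ and order $q=p^n$, and let $d=(q+2)/3$ (an integer). Let $\psi\colon F\to\mathbb{C}$, $\psi(x)=e^{2\pi i\,\mathrm{Tr}(x)/p}$, be the canonical additive character of $F$, where $\mathrm{Tr}\colon F\to\mathbb{F}_p$ is the absolute trace. For $a\in F$ put $W_{F,d}(a)=\sum_{x\in F}\psi(x^d-ax)$, and let $V_{F,d}=\min_{a\in F}\mathrm{val}_p(W_{F,d}(a))$, where $\mathrm{val}_p$ is the $p$-adic valuation extended from $\mathbb{Q}$ to $\mathbb{Q}(e^{2\pi i/p})$, so that $\mathrm{val}_p(1-e^{2\pi i/p})=1/(p-1)$ (and $\mathrm{val}_p(0)=\infty$). Then: 1. $d\equiv 1 \pmod{p-1}$ if and only if $3\mid n$. 2. $\gcd(d,q-1)=1$ if and only if $q$ is congruent to $1$ or $4$ modulo $9$. 3. If $\gcd(d,q-1)=1$, then $V_{F,d}=n/3$. -/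

import Mathlib

open NumberField IsDedekindDomain

noncomputable section

namespace WeilSum

/-- The complex number `e ^ (2 π i / p)`. -/
def zetaC (p : ℕ) : ℂ := Complex.exp (2 * Real.pi * Complex.I / p)

theorem isPrimitiveRoot_zetaC (p : ℕ) [Fact p.Prime] : IsPrimitiveRoot (zetaC p) p :=
  Complex.isPrimitiveRoot_exp p (Fact.out : p.Prime).ne_zero

/-- The cyclotomic field `ℚ(e ^ (2 π i / p))`, as a subfield of `ℂ`. -/
abbrev CycField (p : ℕ) : IntermediateField ℚ ℂ := IntermediateField.adjoin ℚ {zetaC p}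

instance isCyclotomicExtension_cycField (p : ℕ) [Fact p.Prime] :
    IsCyclotomicExtension {p} ℚ (CycField p) := by
  have hζ := isPrimitiveRoot_zetaC p
  change IsCyclotomicExtension {p} ℚ (CycField p).toSubalgebra
  rw [IntermediateField.adjoin_simple_toSubalgebra_of_isAlgebraic
    ((hζ.isIntegral (Fact.out : p.Prime).pos).tower_top (A := ℚ)).isAlgebraic]
  exact hζ.adjoin_isCyclotomicExtension ℚ

instance numberField_cycField (p : ℕ) [Fact p.Prime] : NumberField (CycField p) :=
  IsCyclotomicExtension.numberField {p} ℚ (CycField p)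

/-- `e ^ (2 π i / p)` as an element of the field `ℚ(e ^ (2 π i / p))`. -/
def zeta (p : ℕ) : CycField p := ⟨zetaC p, IntermediateField.mem_adjoin_simple_self ℚ (zetaC p)⟩

theorem isPrimitiveRoot_zeta (p : ℕ) [Fact p.Prime] : IsPrimitiveRoot (zeta p) p :=
  IsPrimitiveRoot.of_map_of_injective (f := (CycField p).val) (isPrimitiveRoot_zetaC p)
    (CycField p).val.injective

/-- The prime ideal of the ring of integers of `ℚ(e ^ (2 π i / p))` generated by
`e ^ (2 π i / p) - 1`; it is the unique prime above `p`. -/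
def primeAbove (p : ℕ) [Fact p.Prime] : HeightOneSpectrum (𝓞 (CycField p)) where
  asIdeal := Ideal.span {(isPrimitiveRoot_zeta p).toInteger - 1}
  isPrime := (Ideal.span_singleton_prime (isPrimitiveRoot_zeta p).zeta_sub_one_prime'.ne_zero).mpr
    (isPrimitiveRoot_zeta p).zeta_sub_one_prime'
  ne_bot := by
    rw [Ne, Ideal.span_singleton_eq_bot]
    exact (isPrimitiveRoot_zeta p).zeta_sub_one_prime'.ne_zero

/-- The `p`-adic valuation (written additively, with `val 0 = ⊤`) on `ℚ(e ^ (2 π i / p))`: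
the discrete valuation at the prime `(e ^ (2 π i / p) - 1)`, rescaled so that
`val (1 - e ^ (2 π i / p)) = 1 / (p - 1)`. -/
def val (p : ℕ) [Fact p.Prime] (x : CycField p) : WithTop ℚ :=
  if x = 0 then ⊤
  else (((-WithZero.log ((primeAbove p).valuation (CycField p) x) : ℤ) : ℚ) / ((p : ℚ) - 1) : ℚ)

/-- The normalization of `val`. -/
theorem val_one_sub_zeta (p : ℕ) [Fact p.Prime] :
    val p (1 - zeta p) = ((1 / ((p : ℚ) - 1) : ℚ) : WithTop ℚ) := by
  have hprime := (isPrimitiveRoot_zeta p).zeta_sub_one_prime'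
  have hne : (1 - zeta p : CycField p) ≠ 0 :=
    sub_ne_zero.mpr ((isPrimitiveRoot_zeta p).ne_one (Fact.out : p.Prime).one_lt).symm
  have h1 : (primeAbove p).valuation (CycField p) (1 - zeta p) = WithZero.exp (-1 : ℤ) := by
    rw [← HeightOneSpectrum.intValuation_singleton (primeAbove p) hprime.ne_zero rfl,
      ← HeightOneSpectrum.valuation_of_algebraMap (K := CycField p), ← Valuation.map_neg]
    congr 1
    simp only [map_sub, map_one, neg_sub]
    rfl
  rw [val, if_neg hne, h1]
  simp

/-- The canonical additive character `ψ(x) = e ^ (2 π i Tr(x) / p)` of `F`, where `Tr` is the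
absolute trace; Mathlib's `ZMod.stdAddChar` is `j ↦ e ^ (2 π i j / p)`. -/
def psi (p : ℕ) [Fact p.Prime] (F : Type*) [Field F] [Algebra (ZMod p) F] (x : F) : ℂ :=
  ZMod.stdAddChar (Algebra.trace (ZMod p) F x)

/-- The Weil sum `W_{F,d}(a) = ∑_{x ∈ F} ψ(x ^ d - a x)`. -/
def weilSum (p : ℕ) [Fact p.Prime] (F : Type*) [Field F] [Fintype F] [Algebra (ZMod p) F]
    (d : ℕ) (a : F) : ℂ :=
  ∑ x : F, psi p F (x ^ d - a * x)

theorem psi_mem (p : ℕ) [Fact p.Prime] (F : Type*) [Field F] [Algebra (ZMod p) F] (x : F) :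
    psi p F x ∈ CycField p := by
  obtain ⟨k, hk⟩ := ZMod.natCast_zmod_surjective (Algebra.trace (ZMod p) F x)
  have h : psi p F x = zetaC p ^ k := by
    rw [psi, ← hk, zetaC, ← Complex.exp_nat_mul]
    have := ZMod.stdAddChar_coe (N := p) (k : ℤ)
    push_cast at this
    rw [this]
    congr 1
    ring
  rw [h]
  exact pow_mem (IntermediateField.mem_adjoin_simple_self ℚ (zetaC p)) k

theorem weilSum_mem (p : ℕ) [Fact p.Prime] (F : Type*) [Field F] [Fintype F]
    [Algebra (ZMod p) F] (d : ℕ) (a : F) : weilSum p F d a ∈ CycField p :=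
  sum_mem fun _ _ => psi_mem p F _

/-- `V_{F,d} = min_{a ∈ F} val_p (W_{F,d}(a))`. -/
def minVal (p : ℕ) [Fact p.Prime] (F : Type*) [Field F] [Fintype F] [Algebra (ZMod p) F]
    (d : ℕ) : WithTop ℚ :=
  Finset.univ.inf' Finset.univ_nonempty fun a : F => val p ⟨weilSum p F d a, weilSum_mem p F d a⟩

end WeilSum

end

/-!
Let `m = (q - 1) / 3`, so that `d = m + 1`. For `x ≠ 0` the element `u = x ^ m` is a cube root of
unity in `F` and `x ^ d = u * x`. Detecting `u` by the characters of the group of cube roots of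
unity expresses the Weil sum through the Gauss sums `g₁`, `g₂` of the two cubic characters
`χ ^ m`, `χ ^ (2 * m)` of `F` (`WeilSum.three_mul_weilSum`):
`3 W(a) = ε q + A(a) g₁ + B(a) g₂`, where `ε` is `1` or `0` according to whether `a ^ 3 = 1`, and
`A(a)`, `B(a)` are sums of cube roots of unity.

The Gauss sums have `p`-adic valuations `n / 3` and `2 n / 3`, when `χ` is the inverse of the
Teichmüller character (`WeilSum.exists_valuation_gaussSum_cubic`). This case of Stickelberger's
theorem has a short proof. The valuation of `g(χ)` is `1 / (p - 1)`, by expanding `ψ` modulo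
`(ζ - 1) ^ 2` (`WeilSum.valuation_gaussSum_inv_section`); it is the same for `χ ^ p ^ i`; and the
valuation is subadditive in the character, because Jacobi sums are integral. As `m` and `2 * m`
have `n` digits `(p - 1) / 3` and `2 (p - 1) / 3` in base `p`, the valuations of `g₁` and `g₂` are
at most `n / 3` and `2 n / 3`. They add up to `n`, the valuation of `q`, so both bounds are
equalities.

Hence every `W(a)` has valuation at least `n / 3`. At `a = 1` the coefficient `A(1)` is a sum of two
cube roots of unity, which divides `2` and so is a unit above `p`; therefore `W(1)` has valuation
exactly `n / 3`.

Gauss sums of `F` involve roots of unity outside `ℚ(ζ)`. The valuations are therefore taken with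
respect to a valuation on all of `ℂ`, which restricts to `ℚ(ζ)` as the given one up to normalization
(`WeilSum.map_eq_zpow`). It comes from a valuation ring dominating `ℤ[μ_{q - 1}]` localized at the
kernel of a residue map to `F` (`exists_valuationSubring_mulChar_section`).

The first two claims are elementary: `(q - 1) / (p - 1) = 1 + p + ⋯ + p ^ (n - 1) ≡ n` modulo `3`,
and `gcd(d, q - 1) = gcd(d, 3)` as `q - 1 = 3 d - 3`.
-/

/-! ### Valuations on fields of characteristic zero above a prime number -/

namespace Valuation

variable {K : Type*} [Field K] {Γ₀ : Type*} [LinearOrderedCommGroupWithZero Γ₀]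
  (v : Valuation K Γ₀)

theorem le_one_of_isIntegral_int {x : K} (hx : IsIntegral ℤ x) : v x ≤ 1 :=
  (Valuation.integer.integers v).mem_of_integral (hx.tower_top (A := v.integer))

theorem natCast_eq_one_of_coprime {p m : ℕ} (hp : v p < 1) (h : Nat.Coprime m p) :
    v m = 1 := by
  have hm : v (m : K) ≤ 1 := v.le_one_of_isIntegral_int (isIntegral_natCast m)
  refine le_antisymm hm (le_of_not_gt fun hlt => ?_)
  -- A Bézout relation between `m` and `p`.
  have hb : ((m : K) * (m.gcdA p : ℤ) + (p : K) * (m.gcdB p : ℤ)) = 1 := by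
    have := Nat.gcd_eq_gcd_ab m p
    rw [Nat.coprime_iff_gcd_eq_one.mp h] at this
    simpa using (congrArg (Int.cast : ℤ → K) this).symm
  have hz (z : ℤ) : v (z : K) ≤ 1 :=
    v.le_one_of_isIntegral_int (isIntegral_intCast z)
  have : v (1 : K) < 1 := by
    rw [← hb]
    refine v.map_add_lt ?_ ?_
    · rw [map_mul]; exact mul_lt_one_of_lt_of_le hlt (hz _)
    · rw [map_mul]; exact mul_lt_one_of_lt_of_le hp (hz _)
  simp at this

theorem map_one_sub_pow_le {x : K} (hx : v x ≤ 1) (k : ℕ) : v (1 - x ^ k) ≤ v (1 - x) := by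
  rw [← mul_neg_geom_sum, map_mul]
  refine mul_le_of_le_one_right' (v.map_sum_le fun i _ => ?_)
  rw [map_pow]
  exact pow_le_one' hx i

/-- Total ramification of `p` in `ℚ(ζ)`: by `∏ (1 - ζ ^ k) = p`, where the factors generate the
same ideal. -/
theorem map_prime_eq_map_one_sub_pow {p : ℕ} (hp : p.Prime) {ζ : K} (hζ : IsPrimitiveRoot ζ p) :
    v p = v (1 - ζ) ^ (p - 1) := by
  obtain ⟨m, rfl⟩ : ∃ m, p = m + 1 := ⟨p - 1, by have := hp.pos; omega⟩
  have hint : v ζ ≤ 1 := v.le_one_of_isIntegral_int (hζ.isIntegral hp.pos)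
  have key : ∀ k ∈ Finset.range m, v (1 - ζ ^ (k + 1)) = v (1 - ζ) := by
    intro k hk
    refine le_antisymm (v.map_one_sub_pow_le hint _) ?_
    have hcop : Nat.Coprime (k + 1) (m + 1) :=
      (Nat.coprime_of_lt_prime (by simp) (by simpa using hk) hp).symm
    obtain ⟨j, -, hj⟩ := (hζ.pow_of_coprime _ hcop).eq_pow_of_pow_eq_one hζ.pow_eq_one
    conv_lhs => rw [← hj]
    exact v.map_one_sub_pow_le (by rw [map_pow]; exact pow_le_one' hint _) j
  have h := hζ.prod_one_sub_pow_eq_order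
  push_cast
  rw [← h, map_prod, Finset.prod_congr rfl key]
  simp

theorem map_one_sub_lt_one {p : ℕ} (hp : p.Prime) (hv : v p < 1) {ζ : K}
    (hζ : IsPrimitiveRoot ζ p) : v (1 - ζ) < 1 := by
  by_contra! h
  rw [v.map_prime_eq_map_one_sub_pow hp hζ] at hv
  exact absurd (one_le_pow₀ h) (not_le.mpr hv)

end Valuation

namespace WeilSum

variable (p : ℕ) [Fact p.Prime]

theorem coe_toInteger_zeta :
    (algebraMap (𝓞 (CycField p)) (CycField p) (isPrimitiveRoot_zeta p).toInteger : ℂ) = zetaC p :=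
  rfl

theorem exists_zeta_sub_one_pow_mul {r : 𝓞 (CycField p)} (hr : r ≠ 0) :
    ∃ (k : ℕ) (s : 𝓞 (CycField p)), s ∉ (primeAbove p).asIdeal ∧
      r = ((isPrimitiveRoot_zeta p).toInteger - 1) ^ k * s := by
  have hprime := (isPrimitiveRoot_zeta p).zeta_sub_one_prime'
  obtain ⟨s, hs, h⟩ :=
    (FiniteMultiplicity.of_not_isUnit hprime.not_isUnit hr).exists_eq_pow_mul_and_not_dvd
  exact ⟨_, s, fun hmem => h (Ideal.mem_span_singleton.mp hmem), hs⟩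

variable {Γ₀ : Type*} [LinearOrderedCommGroupWithZero Γ₀]

/-- Any valuation on `ℂ` above `p` is trivial on the integers of the cyclotomic field outside
`primeAbove p`, because that ideal is maximal and generated by `ζ - 1`. -/
theorem map_eq_one_of_notMem_primeAbove (v : Valuation ℂ Γ₀) (hv : v p < 1)
    {s : 𝓞 (CycField p)} (hs : s ∉ (primeAbove p).asIdeal) :
    v (algebraMap (𝓞 (CycField p)) (CycField p) s : ℂ) = 1 := by
  have hint (t : 𝓞 (CycField p)) : v (algebraMap (𝓞 (CycField p)) (CycField p) t : ℂ) ≤ 1 :=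
    v.le_one_of_isIntegral_int (t.isIntegral_coe.map (CycField p).val.toIntAlgHom)
  have hmax : (primeAbove p).asIdeal.IsMaximal := (primeAbove p).isMaximal
  obtain ⟨t, y, hy, hty⟩ := hmax.exists_inv hs
  obtain ⟨r, rfl⟩ := Ideal.mem_span_singleton.mp hy
  have hπ : v (1 - zetaC p) < 1 :=
    v.map_one_sub_lt_one (Fact.out : p.Prime) hv (isPrimitiveRoot_zetaC p)
  have h1 : (algebraMap (𝓞 (CycField p)) (CycField p) t : ℂ) *
      (algebraMap (𝓞 (CycField p)) (CycField p) s : ℂ)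
      + (zetaC p - 1) * (algebraMap (𝓞 (CycField p)) (CycField p) r : ℂ) = 1 := by
    have := congrArg (fun z => (algebraMap (𝓞 (CycField p)) (CycField p) z : ℂ)) hty
    simp only [map_add, map_mul, map_sub, map_one, AddMemClass.coe_add, MulMemClass.coe_mul,
      AddSubgroupClass.coe_sub, OneMemClass.coe_one, coe_toInteger_zeta] at this
    exact this
  refine le_antisymm (hint s) (le_of_not_gt fun hlt => ?_)
  have : v (1 : ℂ) < 1 := by
    rw [← h1]
    refine v.map_add_lt ?_ ?_
    · rw [map_mul, mul_comm]; exact mul_lt_one_of_lt_of_le hlt (hint _)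
    · rw [map_mul, Valuation.map_sub_swap]; exact mul_lt_one_of_lt_of_le hπ (hint _)
  simp at this

theorem map_integer_eq_pow (v : Valuation ℂ Γ₀) (hv : v p < 1)
    {r : 𝓞 (CycField p)} (hr : r ≠ 0) : ∃ k : ℕ,
      (primeAbove p).valuation (CycField p) (algebraMap (𝓞 (CycField p)) (CycField p) r) =
        WithZero.exp (-(k : ℤ)) ∧
      v (algebraMap (𝓞 (CycField p)) (CycField p) r : ℂ) = v (1 - zetaC p) ^ k := by
  obtain ⟨k, s, hs, rfl⟩ := exists_zeta_sub_one_pow_mul p hr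
  refine ⟨k, ?_, ?_⟩
  · have h1 : (primeAbove p).valuation (CycField p)
        (algebraMap (𝓞 (CycField p)) (CycField p) s) = 1 :=
      ((primeAbove p).valuation_eq_one_iff_notMem).mpr hs
    have h2 : (primeAbove p).valuation (CycField p)
        (algebraMap (𝓞 (CycField p)) (CycField p) ((isPrimitiveRoot_zeta p).toInteger - 1))
        = WithZero.exp (-1 : ℤ) := by
      rw [HeightOneSpectrum.valuation_of_algebraMap]
      exact HeightOneSpectrum.intValuation_singleton (primeAbove p)
        (isPrimitiveRoot_zeta p).zeta_sub_one_prime'.ne_zero rfl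
    rw [map_mul, map_pow, map_mul, map_pow, h1, h2, mul_one, ← WithZero.exp_nsmul]
    simp
  · have h1 := map_eq_one_of_notMem_primeAbove p v hv hs
    simp only [map_mul, map_pow, map_sub, map_one, MulMemClass.coe_mul, SubmonoidClass.coe_pow,
      AddSubgroupClass.coe_sub, OneMemClass.coe_one, h1, mul_one, v.map_sub_swap 1,
      coe_toInteger_zeta]

/-- Any valuation on `ℂ` above `p` restricts to the cyclotomic field as a power of the valuation at
`primeAbove p`. This is what lets `val` be computed in `ℂ`, where the Gauss sums live. -/
theorem map_eq_zpow (v : Valuation ℂ Γ₀) (hv : v p < 1) {x : CycField p} (hx : x ≠ 0) :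
    v (x : ℂ) =
      v (1 - zetaC p) ^ (-WithZero.log ((primeAbove p).valuation (CycField p) x) : ℤ) := by
  obtain ⟨a, b, hb, rfl⟩ := IsFractionRing.div_surjective (A := 𝓞 (CycField p)) x
  have hb0 : b ≠ 0 := nonZeroDivisors.ne_zero hb
  have ha0 : a ≠ 0 := by rintro rfl; simp at hx
  obtain ⟨k, hk, hk'⟩ := map_integer_eq_pow p v hv ha0
  obtain ⟨l, hl, hl'⟩ := map_integer_eq_pow p v hv hb0
  have hne : v (1 - zetaC p) ≠ 0 := by
    rw [Valuation.ne_zero_iff, sub_ne_zero]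
    exact ((isPrimitiveRoot_zetaC p).ne_one (Fact.out : p.Prime).one_lt).symm
  rw [map_div₀, hk, hl, ← WithZero.exp_sub, WithZero.log_exp]
  push_cast
  rw [map_div₀, hk', hl', neg_sub, sub_neg_eq_add, neg_add_eq_sub, zpow_sub₀ hne]
  simp

theorem map_one_sub_zetaC_pos (v : Valuation ℂ Γ₀) : 0 < v (1 - zetaC p) := by
  rw [zero_lt_iff, Valuation.ne_zero_iff, sub_ne_zero]
  exact ((isPrimitiveRoot_zetaC p).ne_one (Fact.out : p.Prime).one_lt).symm

theorem map_one_sub_zetaC_lt_one {v : Valuation ℂ Γ₀} (hv : v p < 1) : v (1 - zetaC p) < 1 :=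
  v.map_one_sub_lt_one (Fact.out : p.Prime) hv (isPrimitiveRoot_zetaC p)

theorem le_val_of_map_le {v : Valuation ℂ Γ₀} (hv : v p < 1) {x : CycField p} {m : ℕ}
    (h : v (x : ℂ) ≤ v (1 - zetaC p) ^ m) : ((m / ((p : ℚ) - 1) : ℚ) : WithTop ℚ) ≤ val p x := by
  by_cases hx : x = 0
  · simp [val, hx]
  rw [val, if_neg hx, WithTop.coe_le_coe]
  rw [map_eq_zpow p v hv hx, ← zpow_natCast, zpow_le_zpow_iff_right_of_lt_one₀
    (map_one_sub_zetaC_pos p v) (map_one_sub_zetaC_lt_one p hv)] at h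
  have hp : (1 : ℚ) < p := by exact_mod_cast (Fact.out : p.Prime).one_lt
  have : (0 : ℚ) < (p : ℚ) - 1 := by linarith
  gcongr
  exact_mod_cast h

theorem val_eq_of_map_eq {v : Valuation ℂ Γ₀} (hv : v p < 1) {x : CycField p} {m : ℕ}
    (h : v (x : ℂ) = v (1 - zetaC p) ^ m) : val p x = ((m / ((p : ℚ) - 1) : ℚ) : WithTop ℚ) := by
  have hx : x ≠ 0 := by
    rintro rfl
    simp only [ZeroMemClass.coe_zero, map_zero] at h
    exact (pow_pos (map_one_sub_zetaC_pos p v) m).ne h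
  rw [val, if_neg hx]
  rw [map_eq_zpow p v hv hx, ← zpow_natCast, zpow_right_inj₀
    (map_one_sub_zetaC_pos p v) (map_one_sub_zetaC_lt_one p hv).ne] at h
  rw [h]
  simp

end WeilSum

/-! ### Valuations of Gauss sums -/

section GaussSum

variable {F : Type*} [Field F] [Fintype F] {K : Type*} [Field K]

theorem MulChar.isIntegral_apply (χ : MulChar F K) (x : F) : IsIntegral ℤ (χ x) := by
  by_cases hx : x = 0
  · simp [hx, isIntegral_zero]
  refine IsIntegral.of_pow (n := Fintype.card F - 1) (Nat.sub_pos_of_lt Fintype.one_lt_card) ?_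
  rw [← map_pow, FiniteField.pow_card_sub_one_eq_one x hx, map_one]
  exact isIntegral_one

theorem AddChar.isIntegral_apply (ψ : AddChar F K) (x : F) : IsIntegral ℤ (ψ x) := by
  refine IsIntegral.of_pow (n := Fintype.card F) Fintype.card_pos ?_
  rw [← AddChar.map_nsmul_eq_pow, card_nsmul_eq_zero, AddChar.map_zero_eq_one]
  exact isIntegral_one

theorem isIntegral_gaussSum (χ : MulChar F K) (ψ : AddChar F K) :
    IsIntegral ℤ (gaussSum χ ψ) :=
  IsIntegral.sum _ fun x _ => (χ.isIntegral_apply x).mul (ψ.isIntegral_apply x)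

theorem isIntegral_jacobiSum (χ φ : MulChar F K) : IsIntegral ℤ (jacobiSum χ φ) :=
  IsIntegral.sum _ fun x _ => (χ.isIntegral_apply x).mul (φ.isIntegral_apply _)

variable {Γ₀ : Type*} [LinearOrderedCommGroupWithZero Γ₀] (v : Valuation K Γ₀)

theorem MulChar.valuation_apply_eq_one (χ : MulChar F K) {x : F} (hx : x ≠ 0) : v (χ x) = 1 := by
  have h : v (χ x) * v (χ x⁻¹) = 1 := by
    rw [← map_mul, ← map_mul, mul_inv_cancel₀ hx, map_one, map_one]
  refine le_antisymm (v.le_one_of_isIntegral_int (χ.isIntegral_apply x)) ?_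
  rw [← h]
  exact mul_le_of_le_one_right' (v.le_one_of_isIntegral_int (χ.isIntegral_apply _))

/-- The additive valuation of Gauss sums is subadditive in the character: the ratio
`g(χ) g(φ) / g(χφ)` is a Jacobi sum, hence integral. For `χφ = 1` the right-hand side is
`v (-1) = 1`. -/
theorem valuation_gaussSum_mul_le (χ φ : MulChar F K) {ψ : AddChar F K} (hψ : ψ ≠ 1) :
    v (gaussSum χ ψ) * v (gaussSum φ ψ) ≤ v (gaussSum (χ * φ) ψ) := by
  by_cases h : χ * φ = 1
  · rw [h, gaussSum_one_left hψ, Valuation.map_neg, map_one]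
    exact mul_le_one' (v.le_one_of_isIntegral_int (isIntegral_gaussSum _ _))
      (v.le_one_of_isIntegral_int (isIntegral_gaussSum _ _))
  · rw [← map_mul, ← jacobiSum_mul_nontrivial h, map_mul]
    exact mul_le_of_le_one_right' (v.le_one_of_isIntegral_int (isIntegral_jacobiSum _ _))

theorem valuation_gaussSum_pow_le (χ : MulChar F K) {ψ : AddChar F K} (hψ : ψ ≠ 1) (k : ℕ) :
    v (gaussSum χ ψ) ^ k ≤ v (gaussSum (χ ^ k) ψ) := by
  induction k with
  | zero => simp [gaussSum_one_left hψ, Valuation.map_neg]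
  | succ k ih =>
    rw [pow_succ, pow_succ]
    exact (mul_le_mul_left ih _).trans (valuation_gaussSum_mul_le v _ _ hψ)

theorem valuation_prod_gaussSum_le {ι : Type*} (s : Finset ι) (χ : ι → MulChar F K)
    {ψ : AddChar F K} (hψ : ψ ≠ 1) :
    ∏ i ∈ s, v (gaussSum (χ i) ψ) ≤ v (gaussSum (∏ i ∈ s, χ i) ψ) := by
  classical
  induction s using Finset.induction_on with
  | empty => simp [gaussSum_one_left hψ, Valuation.map_neg]
  | insert i s hi ih =>
    rw [Finset.prod_insert hi, Finset.prod_insert hi]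
    exact (mul_le_mul_right ih _).trans (valuation_gaussSum_mul_le v _ _ hψ)

theorem valuation_gaussSum_mul_gaussSum_inv {χ : MulChar F K} (hχ : χ ≠ 1) {ψ : AddChar F K}
    (hψ : ψ.IsPrimitive) :
    v (gaussSum χ ψ) * v (gaussSum χ⁻¹ ψ) = v (Fintype.card F) := by
  rw [← gaussSum_mul_gaussSum_eq_card hχ hψ, ← mul_gaussSum_inv_eq_gaussSum χ⁻¹ ψ, map_mul v,
    map_mul v, MulChar.valuation_apply_eq_one v _ (neg_ne_zero.mpr one_ne_zero), one_mul]

end GaussSum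

/-! ### A lift of the identity of a finite field to characteristic zero -/

section Teichmuller

open Polynomial

variable (F : Type*) [Field F] [Fintype F]

/-- The Teichmüller character. `F` is the residue field of the subring `A = ℤ[ζ]` of `ℂ`, with `ζ` a
primitive root of unity of order `#F - 1`, and the residue map `f` has a multiplicative section
`ω`. -/
theorem exists_mulChar_section : ∃ (A : Subring ℂ) (f : A →+* F) (ω : MulChar F A),
    ∀ x, f (ω x) = x := by
  classical
  set N := Fintype.card F - 1 with hN
  have hNpos : 0 < N := Nat.sub_pos_of_lt Fintype.one_lt_card
  obtain ⟨g, hg⟩ := IsCyclic.exists_generator (α := Fˣ)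
  have hgN : IsPrimitiveRoot (g : F) N := by
    rw [IsPrimitiveRoot.coe_units_iff, hN, ← Fintype.card_units, ← Nat.card_eq_fintype_card,
      ← orderOf_eq_card_of_forall_mem_zpowers hg]
    exact IsPrimitiveRoot.orderOf g
  have hζ := Complex.isPrimitiveRoot_exp N hNpos.ne'
  set ζ := Complex.exp (2 * Real.pi * Complex.I / N)
  have hint : IsIntegral ℤ ζ := hζ.isIntegral hNpos
  let f₀ : AdjoinRoot (minpoly ℤ ζ) →+* F := AdjoinRoot.lift (Int.castRingHom F) g (by
    rw [← cyclotomic_eq_minpoly hζ hNpos, eval₂_eq_eval_map, map_cyclotomic]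
    exact hgN.isRoot_cyclotomic hNpos)
  let e := minpoly.equivAdjoin hint
  let A : Subring ℂ := (Algebra.adjoin ℤ {ζ}).toSubring
  let f : A →+* F := f₀.comp (e.symm : _ →+* _)
  let z : A := ⟨ζ, Algebra.self_mem_adjoin_singleton ℤ ζ⟩
  have hfz : f z = g := by
    have : e (AdjoinRoot.root _) = z := by
      simp [e, z]
    change f₀ (e.symm z) = g
    rw [← this, AlgEquiv.symm_apply_apply]
    simp [f₀]
  have hzN : z ^ N = 1 := Subtype.ext hζ.pow_eq_one
  let zu : Aˣ := Units.ofPowEqOne z N hzN hNpos.ne'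
  have hzu : zu ∈ rootsOfUnity (Fintype.card Fˣ) A := by
    rw [mem_rootsOfUnity, Fintype.card_units]
    exact Units.ext (by simpa [zu] using hzN)
  refine ⟨A, f, MulChar.ofRootOfUnity hzu hg, fun x => ?_⟩
  by_cases hx : x = 0
  · rw [hx, MulChar.map_zero, map_zero]
  obtain ⟨k, hk⟩ := (Submonoid.mem_powers_iff _ _).mp
    (mem_powers_iff_mem_zpowers.mpr (hg (Units.mk0 x hx)))
  have hxk : x = (g : F) ^ k := by
    rw [← Units.val_pow_eq_pow_val, hk, Units.val_mk0]
  rw [hxk, map_pow, map_pow, MulChar.ofRootOfUnity_spec]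
  simp [zu, hfz]

/-- Some valuation on `ℂ` is less than `1` on the kernel of the residue map split by the Teichmüller
character. -/
theorem exists_valuationSubring_mulChar_section :
    ∃ (B : ValuationSubring ℂ) (A : Subring ℂ) (f : A →+* F) (ω : MulChar F A),
      (∀ x, f (ω x) = x) ∧ ∀ a : A, f a = 0 → B.valuation a < 1 := by
  obtain ⟨A, f, ω, hω⟩ := exists_mulChar_section F
  obtain ⟨B, -, hB⟩ := Ideal.image_subset_nonunits_valuationSubring (RingHom.ker f)
    (RingHom.ker_ne_top f)
  exact ⟨B, A, f, ω, hω, fun a ha => B.mem_nonunits_iff.mp (hB ⟨a, ha, rfl⟩)⟩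

end Teichmuller

namespace WeilSum

section GaussSumValuation

variable (p : ℕ) [Fact p.Prime] (F : Type*) [Field F] [Algebra (ZMod p) F]

/-! ### The canonical additive character -/

/-- The canonical additive character of `F`, bundled as an `AddChar`. -/
noncomputable def psiChar : AddChar F ℂ :=
  (ZMod.stdAddChar (N := p)).compAddMonoidHom (Algebra.trace (ZMod p) F).toAddMonoidHom

theorem psiChar_apply (x : F) : psiChar p F x = psi p F x := rfl

theorem psi_eq_zetaC_pow (x : F) :
    psi p F x = zetaC p ^ (Algebra.trace (ZMod p) F x).val := by
  have h := ZMod.stdAddChar_coe (N := p) ((Algebra.trace (ZMod p) F x).val : ℤ)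
  push_cast at h
  rw [ZMod.natCast_zmod_val] at h
  rw [psi, h, zetaC, ← Complex.exp_nat_mul]
  congr 1
  ring

variable [Fintype F]

theorem psiChar_ne_one : psiChar p F ≠ 1 := by
  intro h
  obtain ⟨x, hx⟩ := Algebra.trace_surjective (ZMod p) F 1
  have h1 : psiChar p F x = 1 := by rw [h, AddChar.one_apply]
  rw [psiChar_apply, psi_eq_zetaC_pow, hx, ZMod.val_one, pow_one] at h1
  exact (isPrimitiveRoot_zetaC p).ne_one (Fact.out : p.Prime).one_lt h1

theorem isPrimitive_psiChar : (psiChar p F).IsPrimitive :=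
  AddChar.IsPrimitive.of_ne_one (psiChar_ne_one p F)

theorem psiChar_pow_char (x : F) : psiChar p F (x ^ p) = psiChar p F x := by
  have : CharP F p := charP_of_injective_algebraMap (algebraMap (ZMod p) F).injective p
  change psi p F (x ^ p) = psi p F x
  rw [psi, psi]
  congr 1
  have h := Algebra.trace_eq_of_algEquiv (FiniteField.frobeniusAlgEquiv (ZMod p) F p) x
  simpa using h

/-- Gauss sums are invariant under `χ ↦ χ ^ p`, since the trace is invariant under Frobenius. -/
theorem gaussSum_pow_char (χ : MulChar F ℂ) :
    gaussSum (χ ^ p) (psiChar p F) = gaussSum χ (psiChar p F) := by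
  have : CharP F p := charP_of_injective_algebraMap (algebraMap (ZMod p) F).injective p
  refine Fintype.sum_bijective (frobenius F p) (bijective_frobenius F p) _ _ fun x => ?_
  rw [frobenius_def, psiChar_pow_char, χ.pow_apply' (Fact.out : p.Prime).ne_zero, map_pow]

theorem gaussSum_pow_char_pow (χ : MulChar F ℂ) (i : ℕ) :
    gaussSum (χ ^ p ^ i) (psiChar p F) = gaussSum χ (psiChar p F) := by
  induction i with
  | zero => simp
  | succ i ih => rw [pow_succ, pow_mul, gaussSum_pow_char, ih]

/-- In `Tr x = ∑ x ^ (p ^ i)`, only the term `i = 0` survives multiplication by `x⁻¹` and summation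
over `F`. -/
theorem sum_inv_mul_trace :
    ∑ x : F, x⁻¹ * algebraMap (ZMod p) F (Algebra.trace (ZMod p) F x) = -1 := by
  classical
  have : CharP F p := charP_of_injective_algebraMap (algebraMap (ZMod p) F).injective p
  have hcard : Fintype.card F = p ^ Module.finrank (ZMod p) F := by
    rw [Module.card_eq_pow_finrank (K := ZMod p), ZMod.card]
  have hn : 0 < Module.finrank (ZMod p) F := Module.finrank_pos
  have hp : 1 < p := (Fact.out : p.Prime).one_lt
  simp_rw [FiniteField.algebraMap_trace_eq_sum_pow, Finset.mul_sum]
  rw [Finset.sum_comm, Finset.sum_eq_single_of_mem 0 (Finset.mem_range.mpr hn)]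
  · have h (x : F) : x⁻¹ * x ^ Nat.card (ZMod p) ^ 0 = 1 - if x = 0 then 1 else 0 := by
      by_cases hx : x = 0 <;> simp [hx]
    simp_rw [h]
    simp
  · intro i hi hi0
    have h1 : 1 < p ^ i := Nat.one_lt_pow hi0 hp
    have h2 : p ^ i < Fintype.card F := by
      rw [hcard]
      exact Nat.pow_lt_pow_right hp (Finset.mem_range.mp hi)
    rw [← FiniteField.sum_pow_lt_card_sub_one F (p ^ i - 1) (by omega)]
    refine Finset.sum_congr rfl fun x _ => ?_
    rw [Nat.card_zmod]
    by_cases hx : x = 0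
    · simp [hx, Nat.sub_ne_zero_of_lt h1]
    · rw [pow_sub₀ _ hx h1.le, pow_one, mul_comm]

/-! ### The Gauss sums of cubic characters -/

variable {F} {Γ₀ : Type*} [LinearOrderedCommGroupWithZero Γ₀]

theorem exists_pow_eq_add_mul_sq {K : Type*} [Field K] (v : Valuation K Γ₀) {ζ : K}
    (hζ : v ζ ≤ 1) (t : ℕ) :
    ∃ c, v c ≤ 1 ∧ ζ ^ t = 1 + t * (ζ - 1) + c * (ζ - 1) ^ 2 := by
  induction t with
  | zero => exact ⟨0, by simp, by simp⟩
  | succ t ih =>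
    obtain ⟨c, hc, h⟩ := ih
    refine ⟨t + c * ζ, v.map_add_le (v.le_one_of_isIntegral_int (isIntegral_natCast t)) ?_, ?_⟩
    · rw [map_mul]
      exact mul_le_one' hc hζ
    · rw [pow_succ, h]
      push_cast
      ring

/-- The Gauss sum of the inverse Teichmüller character has the valuation of `1 - ζ`. Indeed
`ψ x ≡ 1 + (Tr x) (ζ - 1)` modulo `(ζ - 1) ^ 2`, and `∑ ω⁻¹ x * Tr x` has the nonzero residue
`∑ x⁻¹ * Tr x = -1`. -/
theorem valuation_gaussSum_inv_section (hp2 : p ≠ 2) {A : Subring ℂ} {f : A →+* F}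
    {ω : MulChar F A} (hω : ∀ x, f (ω x) = x) {v : Valuation ℂ Γ₀}
    (hv : ∀ a : A, f a = 0 → v a < 1) :
    v (gaussSum (ω.ringHomComp A.subtype)⁻¹ (psiChar p F)) = v (1 - zetaC p) := by
  have : CharP F p := charP_of_injective_algebraMap (algebraMap (ZMod p) F).injective p
  have hvp : v p < 1 := by simpa using hv (p : A) (by simp)
  have hζ : v (zetaC p) ≤ 1 := v.le_one_of_isIntegral_int
    ((isPrimitiveRoot_zetaC p).isIntegral (Fact.out : p.Prime).pos)
  set χ := (ω.ringHomComp A.subtype)⁻¹ with hχ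
  have hχ_apply (x : F) : χ x = (ω x⁻¹ : A) := by
    rw [hχ, MulChar.inv_apply']; rfl
  -- Nontriviality makes the constant term `∑ χ x` of the Gauss sum vanish.
  have hχ1 : χ ≠ 1 := by
    intro h
    have h1 : χ (-1) = 1 := by rw [h, MulChar.one_apply (by simp)]
    rw [hχ_apply] at h1
    have h2 : f (ω (-1)⁻¹) = 1 := by
      rw [show ω (-1)⁻¹ = 1 from Subtype.ext h1, map_one]
    rw [hω, inv_neg_one] at h2
    exact Ring.neg_one_ne_one_of_char_ne_two (by rwa [ringChar.eq F p]) h2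
  choose c hc hcζ using exists_pow_eq_add_mul_sq v hζ
  -- `S` is the coefficient of `ζ - 1` in the Gauss sum.
  let t : F → ℕ := fun x => (Algebra.trace (ZMod p) F x).val
  let S : A := ∑ x, ω x⁻¹ * t x
  have hS : v (S : ℂ) = 1 := by
    have hfS : f (S + 1) = 0 := by
      have ht (x : F) : ((t x : ℕ) : F) = algebraMap (ZMod p) F (Algebra.trace (ZMod p) F x) := by
        rw [← map_natCast (algebraMap (ZMod p) F), ZMod.natCast_zmod_val]
      simp [S, hω, ht, sum_inv_mul_trace p F]
    have := hv _ hfS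
    have h1 : (S : ℂ) = ((S + 1 : A) : ℂ) + (-1) := by push_cast; ring
    rw [h1, v.map_add_eq_of_lt_right (by simpa using this)]
    simp
  have hsum : gaussSum χ (psiChar p F) =
      (S + (∑ x, χ x * c (t x)) * (zetaC p - 1)) * (zetaC p - 1) := by
    have h (x : F) : χ x * psiChar p F x = χ x + χ x * t x * (zetaC p - 1)
        + χ x * c (t x) * (zetaC p - 1) * (zetaC p - 1) := by
      rw [psiChar_apply, psi_eq_zetaC_pow, hcζ]
      ring
    rw [gaussSum, Finset.sum_congr rfl fun x _ => h x, Finset.sum_add_distrib,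
      Finset.sum_add_distrib, MulChar.sum_eq_zero_of_ne_one hχ1]
    simp only [S, ← Finset.sum_mul, add_mul, zero_add, hχ_apply]
    push_cast
    rfl
  have hπ := v.map_one_sub_lt_one (Fact.out : p.Prime) hvp (isPrimitiveRoot_zetaC p)
  rw [hsum, map_mul, v.map_sub_swap, v.map_add_eq_of_lt_left, hS, one_mul]
  rw [hS, map_mul, v.map_sub_swap, mul_comm]
  refine mul_lt_one_of_lt_of_le hπ (v.map_sum_le fun x _ => ?_)
  rw [map_mul]
  exact mul_le_one' (v.le_one_of_isIntegral_int (χ.isIntegral_apply x)) (hc _)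

/-- If the Gauss sum of `χ` has the valuation of `1 - ζ`, then the Gauss sum of `χ ^ k`, where `k` is
`c` times the number with `n` base-`p` digits `1`, has at least the valuation (in the multiplicative
order) of `(1 - ζ) ^ (n * c)`. For `c < p` the exponent is the digit sum of `k`. -/
theorem le_valuation_gaussSum_repdigit (v : Valuation ℂ Γ₀) {χ : MulChar F ℂ}
    (hχ : v (gaussSum χ (psiChar p F)) = v (1 - zetaC p)) (n c : ℕ) :
    v (1 - zetaC p) ^ (n * c) ≤
      v (gaussSum (χ ^ (c * ∑ i ∈ Finset.range n, p ^ i)) (psiChar p F)) := by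
  have hψ := psiChar_ne_one p F
  calc v (1 - zetaC p) ^ (n * c)
      = (∏ i ∈ Finset.range n, v (gaussSum (χ ^ p ^ i) (psiChar p F))) ^ c := by
        simp_rw [gaussSum_pow_char_pow, hχ, Finset.prod_const, Finset.card_range, pow_mul]
    _ ≤ v (gaussSum (∏ i ∈ Finset.range n, χ ^ p ^ i) (psiChar p F)) ^ c :=
        pow_le_pow_left' (valuation_prod_gaussSum_le v _ _ hψ) c
    _ ≤ _ := by
        rw [Finset.prod_pow_eq_pow_sum, mul_comm c, pow_mul]
        exact valuation_gaussSum_pow_le v _ hψ c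

variable (F) in
theorem exists_isPrimitiveRoot_units : ∃ g : Fˣ, IsPrimitiveRoot g (Fintype.card F - 1) := by
  classical
  obtain ⟨g, hg⟩ := IsCyclic.exists_generator (α := Fˣ)
  refine ⟨g, ?_⟩
  rw [← Fintype.card_units, ← Nat.card_eq_fintype_card, ← orderOf_eq_card_of_forall_mem_zpowers hg]
  exact IsPrimitiveRoot.orderOf g

/-- The exponents `m = (q - 1) / 3` and `2 * m` have `n` digits `c` and `2 * c` in base `p`. The two
resulting bounds are sharp because the product of the two Gauss sums has absolute value `q`. -/
theorem valuation_gaussSum_cubic {n c m : ℕ} (hp : p = 3 * c + 1)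
    (hcard : Fintype.card F = p ^ n) (hm : 3 * m + 1 = Fintype.card F)
    (v : Valuation ℂ Γ₀) {χ : MulChar F ℂ} (hinj : Function.Injective χ)
    (hχ : v (gaussSum χ (psiChar p F)) = v (1 - zetaC p)) :
    v (gaussSum (χ ^ m) (psiChar p F)) = v (1 - zetaC p) ^ (n * c) ∧
      v (gaussSum (χ ^ (2 * m)) (psiChar p F)) = v (1 - zetaC p) ^ (2 * (n * c)) := by
  have hgeom : m = c * ∑ i ∈ Finset.range n, p ^ i := by
    have h := geom_sum_mul_add (3 * c) n
    rw [← hp, ← hcard, ← hm] at h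
    linarith
  have hθ : v (1 - zetaC p) ^ (n * c) ≤ v (gaussSum (χ ^ m) (psiChar p F)) := by
    rw [hgeom]
    exact le_valuation_gaussSum_repdigit p v hχ n c
  have hθ2 : v (1 - zetaC p) ^ (2 * (n * c)) ≤ v (gaussSum (χ ^ (2 * m)) (psiChar p F)) := by
    rw [hgeom, mul_left_comm 2 n c, ← mul_assoc 2 c]
    exact le_valuation_gaussSum_repdigit p v hχ n (2 * c)
  have hχ3 : χ ^ m * χ ^ (2 * m) = 1 := by
    classical
    rw [← pow_add, ← χ.pow_card_eq_one, Fintype.card_units]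
    congr 1
    omega
  have hχm : χ ^ m ≠ 1 := by
    intro h
    have hm0 : 0 < m := by
      have := Fintype.one_lt_card (α := F)
      omega
    obtain ⟨g, hg⟩ := exists_isPrimitiveRoot_units F
    have h1 : χ ((g ^ m : Fˣ) : F) = χ 1 := by
      rw [Units.val_pow_eq_pow_val, map_pow, ← MulChar.pow_apply_coe, h, MulChar.one_apply_coe,
        map_one]
    have h2 := hg.dvd_of_pow_eq_one m (Units.ext (hinj h1))
    have := Nat.le_of_dvd hm0 h2
    omega
  have hprod : v (gaussSum (χ ^ m) (psiChar p F)) * v (gaussSum (χ ^ (2 * m)) (psiChar p F)) =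
      v (1 - zetaC p) ^ (n * c) * v (1 - zetaC p) ^ (2 * (n * c)) := by
    rw [← inv_eq_of_mul_eq_one_right hχ3,
      valuation_gaussSum_mul_gaussSum_inv v hχm (isPrimitive_psiChar p F), hcard, Nat.cast_pow,
      map_pow, v.map_prime_eq_map_one_sub_pow (Fact.out : p.Prime) (isPrimitiveRoot_zetaC p),
      ← pow_mul, ← pow_add]
    congr 1
    have : p - 1 = 3 * c := by omega
    rw [this]
    ring
  have hπ := map_one_sub_zetaC_pos p v
  have := (mul_eq_mul_iff_eq_and_eq_of_pos hθ hθ2 (pow_pos hπ _)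
    ((pow_pos hπ _).trans_le hθ2)).mp hprod.symm
  exact ⟨this.1.symm, this.2.symm⟩

variable (F) in
/-- Stickelberger's theorem for the two cubic characters, with respect to some valuation on `ℂ`
above `p`. The characters are powers of an injective one, the inverse Teichmüller character. -/
theorem exists_valuation_gaussSum_cubic {n c m : ℕ} (hp : p = 3 * c + 1)
    (hcard : Fintype.card F = p ^ n) (hm : 3 * m + 1 = Fintype.card F) :
    ∃ (B : ValuationSubring ℂ) (χ : MulChar F ℂ), B.valuation p < 1 ∧ Function.Injective χ ∧
      B.valuation (gaussSum (χ ^ m) (psiChar p F)) = B.valuation (1 - zetaC p) ^ (n * c) ∧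
      B.valuation (gaussSum (χ ^ (2 * m)) (psiChar p F)) =
        B.valuation (1 - zetaC p) ^ (2 * (n * c)) := by
  have : CharP F p := charP_of_injective_algebraMap (algebraMap (ZMod p) F).injective p
  obtain ⟨B, A, f, ω, hω, hB⟩ := exists_valuationSubring_mulChar_section F
  have hinj : Function.Injective ⇑((ω.ringHomComp A.subtype)⁻¹) := by
    intro x y hxy
    simp only [MulChar.inv_apply', MulChar.ringHomComp_apply] at hxy
    have := congrArg f (A.subtype_injective hxy)
    simpa [hω] using this
  have hp2 : p ≠ 2 := by omega
  exact ⟨B, _, by simpa using hB (p : A) (by simp), hinj,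
    valuation_gaussSum_cubic p hp hcard hm B.valuation hinj
      (valuation_gaussSum_inv_section p hp2 hω hB)⟩

end GaussSumValuation

section WeilSumValuation

/-! ### Weil sums in terms of Gauss sums -/

open Polynomial

variable (p : ℕ) [Fact p.Prime] {F : Type*} [Field F] [Fintype F] [Algebra (ZMod p) F]

theorem gaussSum_one_mulShift [DecidableEq F] (b : F) :
    gaussSum (1 : MulChar F ℂ) ((psiChar p F).mulShift b) =
      (if b = 0 then (Fintype.card F : ℂ) else 0) - 1 := by
  by_cases hb : b = 0
  · subst hb
    rw [AddChar.mulShift_zero, gaussSum_one_one, Nat.card_eq_fintype_card, Fintype.card_units,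
      Nat.cast_sub Fintype.card_pos]
    simp
  · rw [gaussSum_one_left (isPrimitive_psiChar p F hb)]
    simp [hb]

/-- Orthogonality for the characters of the group of cube roots of unity. -/
theorem one_add_mulChar_add_sq {F : Type*} [Field F] [DecidableEq F] {χ : MulChar F ℂ}
    (hχ : Function.Injective χ) {y : F} (hy : y ^ 3 = 1) : 1 + χ y + χ y ^ 2 = if y = 1 then 3 else 0 := by
  by_cases h : y = 1
  · simp [h]; norm_num
  · rw [if_neg h]
    have h1 : χ y - 1 ≠ 0 := sub_ne_zero.mpr fun h' => h (hχ (by rw [h', map_one]))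
    have h3 : χ y ^ 3 = 1 := by rw [← map_pow, hy, map_one]
    refine (mul_eq_zero.mp ?_).resolve_left h1
    linear_combination h3

theorem card_nthRootsFinset_three {m : ℕ} (hm : 3 * m + 1 = Fintype.card F) :
    (nthRootsFinset 3 (1 : F)).card = 3 := by
  obtain ⟨g, hg⟩ := exists_isPrimitiveRoot_units F
  have hpos := Fintype.one_lt_card (α := F)
  have h := (IsPrimitiveRoot.coe_units_iff.mpr hg).pow (by omega)
    (show Fintype.card F - 1 = m * 3 by omega)
  exact h.card_nthRootsFinset

/-- The `x ≠ 0` are sorted by the cube root of unity `u = x ^ m`, for which `x ^ (m + 1) = u * x`; the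
condition `x ^ m = u` is detected by the characters of the group of cube roots of unity. -/
theorem three_mul_weilSum [DecidableEq F] {m : ℕ} (hm : 3 * m + 1 = Fintype.card F)
    {χ : MulChar F ℂ} (hχ : Function.Injective χ) (a : F) :
    3 * weilSum p F (m + 1) a = (if a ^ 3 = 1 then (Fintype.card F : ℂ) else 0) +
      ∑ u ∈ nthRootsFinset 3 (1 : F),
        χ u⁻¹ * gaussSum (χ ^ m) ((psiChar p F).mulShift (u - a)) +
      ∑ u ∈ nthRootsFinset 3 (1 : F),
        χ u⁻¹ ^ 2 * gaussSum (χ ^ (2 * m)) ((psiChar p F).mulShift (u - a)) := by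
  have hm0 : m ≠ 0 := by
    have := Fintype.one_lt_card (α := F)
    omega
  set ψ := psiChar p F with hψ
  have hterm (x : F) : 3 * psi p F (x ^ (m + 1) - a * x) = (if x = 0 then 3 else 0) +
      ∑ u ∈ nthRootsFinset 3 (1 : F), ((1 : MulChar F ℂ) x * ψ.mulShift (u - a) x
        + χ u⁻¹ * ((χ ^ m) x * ψ.mulShift (u - a) x)
        + χ u⁻¹ ^ 2 * ((χ ^ (2 * m)) x * ψ.mulShift (u - a) x)) := by
    by_cases hx : x = 0
    · subst hx
      simp [MulChar.map_zero, ← psiChar_apply]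
    · have hy : (x ^ m) ^ 3 = 1 := by
        rw [← pow_mul, ← FiniteField.pow_card_sub_one_eq_one x hx]
        congr 1
        omega
      rw [if_neg hx, zero_add, Finset.sum_eq_single_of_mem (x ^ m)
        ((mem_nthRootsFinset (by norm_num) _).mpr hy)]
      · have hxm : x ^ m ≠ 0 := pow_ne_zero _ hx
        have h1 : χ (x ^ m)⁻¹ * χ x ^ m = 1 := by
          rw [← map_pow, ← map_mul, inv_mul_cancel₀ hxm, map_one]
        rw [MulChar.one_apply (isUnit_iff_ne_zero.mpr hx), χ.pow_apply' hm0,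
          χ.pow_apply' (by omega), AddChar.mulShift_apply, ← psiChar_apply, ← hψ, mul_comm 2 m,
          pow_mul, show x ^ (m + 1) - a * x = (x ^ m - a) * x by ring]
        linear_combination (-(1 + (χ (x ^ m)⁻¹ * χ x ^ m + 1)) * ψ ((x ^ m - a) * x)) * h1
      · intro u hu hux
        have hu3 : u ^ 3 = 1 := (mem_nthRootsFinset (by norm_num) _).mp hu
        have hu0 : u ≠ 0 := by rintro rfl; norm_num at hu3
        have h := one_add_mulChar_add_sq hχ (y := u⁻¹ * x ^ m) (by
          rw [mul_pow, inv_pow, hu3, hy]; simp)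
        have hne : u⁻¹ * x ^ m ≠ 1 := fun h' => hux ((inv_mul_eq_one₀ hu0).mp h')
        rw [if_neg hne] at h
        rw [MulChar.one_apply (isUnit_iff_ne_zero.mpr hx), χ.pow_apply' hm0,
          χ.pow_apply' (by omega), mul_comm 2 m, pow_mul]
        rw [map_mul, map_pow] at h
        linear_combination ψ.mulShift (u - a) x * h
  have hcard : (∑ u ∈ nthRootsFinset 3 (1 : F), gaussSum (1 : MulChar F ℂ) (ψ.mulShift (u - a))) =
      (if a ^ 3 = 1 then (Fintype.card F : ℂ) else 0) - 3 := by
    simp_rw [hψ, gaussSum_one_mulShift, sub_eq_zero, Finset.sum_sub_distrib, Finset.sum_ite_eq',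
      mem_nthRootsFinset (show 0 < 3 by norm_num)]
    rw [Finset.sum_const, card_nthRootsFinset_three hm]
    simp
  rw [weilSum, Finset.mul_sum, Finset.sum_congr rfl fun x _ => hterm x, Finset.sum_add_distrib,
    Finset.sum_comm]
  simp only [Finset.sum_add_distrib, ← Finset.mul_sum]
  change _ + (∑ u ∈ nthRootsFinset 3 (1 : F), gaussSum (1 : MulChar F ℂ) (ψ.mulShift (u - a)) +
    ∑ u ∈ nthRootsFinset 3 (1 : F), χ u⁻¹ * gaussSum (χ ^ m) (ψ.mulShift (u - a)) +
    ∑ u ∈ nthRootsFinset 3 (1 : F), χ u⁻¹ ^ 2 * gaussSum (χ ^ (2 * m)) (ψ.mulShift (u - a))) = _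
  rw [hcard]
  simp
  ring

/-! ### The valuation of the Weil sums -/

variable {Γ₀ : Type*} [LinearOrderedCommGroupWithZero Γ₀]

theorem valuation_gaussSum_mulShift_le (v : Valuation ℂ Γ₀) {θ : MulChar F ℂ} (hθ : θ ≠ 1)
    (b : F) :
    v (gaussSum θ ((psiChar p F).mulShift b)) ≤ v (gaussSum θ (psiChar p F)) := by
  by_cases hb : b = 0
  · subst hb
    simp [gaussSum_one_right hθ]
  · rw [← Units.val_mk0 hb, gaussSum_mulShift_eq, map_mul,
      MulChar.valuation_apply_eq_one v _ (by simpa using hb), one_mul]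

theorem valuation_sum_nthRoots_gaussSum_le (v : Valuation ℂ Γ₀) {θ : MulChar F ℂ}
    (hθ : θ ≠ 1) (χ : MulChar F ℂ) (j : ℕ) (a : F) :
    v (∑ u ∈ nthRootsFinset 3 (1 : F),
        χ u⁻¹ ^ j * gaussSum θ ((psiChar p F).mulShift (u - a))) ≤
      v (gaussSum θ (psiChar p F)) := by
  refine v.map_sum_le fun u hu => ?_
  rw [map_mul, map_pow]
  exact (mul_le_of_le_one_left' (pow_le_one' (v.le_one_of_isIntegral_int
    (χ.isIntegral_apply _)) j)).trans (valuation_gaussSum_mulShift_le p v hθ _)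

theorem valuation_add_eq_one_of_pow_three {K : Type*} [Field K] {v : Valuation K Γ₀}
    (h2 : v 2 = 1) {s t : K} (hs : s ^ 3 = 1) (ht : t ^ 3 = 1) : v (s + t) = 1 := by
  have hint {x : K} (hx : x ^ 3 = 1) : IsIntegral ℤ x :=
    IsIntegral.of_pow (n := 3) (by norm_num) (hx ▸ isIntegral_one)
  have hs' := hint hs
  have ht' := hint ht
  have h : v (s + t) * v (s ^ 2 - s * t + t ^ 2) = 1 := by
    rw [← map_mul, ← h2]
    congr 1
    linear_combination hs + ht
  refine le_antisymm (v.le_one_of_isIntegral_int (hs'.add ht')) ?_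
  rw [← h]
  exact mul_le_of_le_one_right' (v.le_one_of_isIntegral_int
    (((hs'.pow 2).sub (hs'.mul ht')).add (ht'.pow 2)))

/-- At `a = 1` the term `u = 1` vanishes, so that the coefficient of the Gauss sum of `χ ^ m` is a sum
of two cube roots of unity, which is a unit above `p`. -/
theorem valuation_sum_nthRoots_gaussSum_one {v : Valuation ℂ Γ₀} (h2 : v 2 = 1) {m : ℕ}
    (hm : 3 * m + 1 = Fintype.card F) (χ : MulChar F ℂ) (hθ : χ ^ m ≠ 1) :
    v (∑ u ∈ nthRootsFinset 3 (1 : F),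
        χ u⁻¹ * gaussSum (χ ^ m) ((psiChar p F).mulShift (u - 1))) =
      v (gaussSum (χ ^ m) (psiChar p F)) := by
  classical
  have h1mem : (1 : F) ∈ nthRootsFinset 3 (1 : F) := by simp
  obtain ⟨u, w, huw, hset⟩ := Finset.card_eq_two.mp
    (show ((nthRootsFinset 3 (1 : F)).erase 1).card = 2 by
      rw [Finset.card_erase_of_mem h1mem, card_nthRootsFinset_three hm])
  have hmem {x : F} (hx : x ∈ ({u, w} : Finset F)) : x ≠ 1 ∧ x ^ 3 = 1 := by
    rw [← hset, Finset.mem_erase, mem_nthRootsFinset (by norm_num)] at hx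
    exact hx
  have hθ3 : (χ ^ m) ^ 3 = 1 := by
    rw [← pow_mul, ← χ.pow_card_eq_one, Fintype.card_units]
    congr 1
    omega
  have hterm {x : F} (hx : x ∈ ({u, w} : Finset F)) :
      χ x⁻¹ * gaussSum (χ ^ m) ((psiChar p F).mulShift (x - 1)) =
        χ x⁻¹ * (χ ^ m)⁻¹ (x - 1) * gaussSum (χ ^ m) (psiChar p F) := by
    have hx1 : x - 1 ≠ 0 := sub_ne_zero.mpr (hmem hx).1
    rw [← Units.val_mk0 hx1, gaussSum_mulShift_eq, mul_assoc]
  have hcube {x : F} (hx : x ∈ ({u, w} : Finset F)) :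
      (χ x⁻¹ * (χ ^ m)⁻¹ (x - 1)) ^ 3 = 1 := by
    have hx1 : x - 1 ≠ 0 := sub_ne_zero.mpr (hmem hx).1
    rw [mul_pow, ← map_pow, inv_pow, (hmem hx).2, inv_one, map_one, one_mul,
      ← MulChar.pow_apply' _ (by norm_num), inv_pow, hθ3, inv_one,
      MulChar.one_apply (isUnit_iff_ne_zero.mpr hx1)]
  rw [← Finset.add_sum_erase _ _ h1mem, hset, Finset.sum_pair huw, hterm (x := u) (by simp),
    hterm (x := w) (by simp), ← add_mul, sub_self, AddChar.mulShift_zero, gaussSum_one_right hθ, mul_zero,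
    zero_add, map_mul, valuation_add_eq_one_of_pow_three h2 (hcube (by simp)) (hcube (by simp)),
    one_mul]

variable (F) in
theorem minVal_eq {n c m : ℕ} (hp : p = 3 * c + 1)
    (hcard : Fintype.card F = p ^ n) (hm : 3 * m + 1 = Fintype.card F) :
    minVal p F (m + 1) = (((n : ℚ) / 3 : ℚ) : WithTop ℚ) := by
  classical
  have hpp : p.Prime := Fact.out
  have hc : 0 < c := by have := hpp.two_le; omega
  have hn : 0 < n := by
    have := Fintype.one_lt_card (α := F)
    rw [hcard] at this
    exact Nat.pos_of_ne_zero fun h => by simp [h] at this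
  obtain ⟨B, χ, hvp, hinj, h1, h2⟩ := exists_valuation_gaussSum_cubic p F hp hcard hm
  generalize B.valuation = v at *
  set N := n * c with hN
  have hNpos : 0 < N := Nat.mul_pos hn hc
  set π := v (1 - zetaC p) with hπ
  have hπ0 : 0 < π := map_one_sub_zetaC_pos p v
  have hπ1 : π < 1 := map_one_sub_zetaC_lt_one p hvp
  have hθ1 : χ ^ m ≠ 1 := by
    intro h
    rw [h, gaussSum_one_left (psiChar_ne_one p F), Valuation.map_neg, map_one] at h1
    exact (pow_lt_one₀ hπ0.le hπ1 hNpos.ne').ne h1.symm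
  have hθ2 : χ ^ (2 * m) ≠ 1 := by
    intro h
    rw [h, gaussSum_one_left (psiChar_ne_one p F), Valuation.map_neg, map_one] at h2
    exact (pow_lt_one₀ hπ0.le hπ1 (by omega)).ne h2.symm
  have hq : v (Fintype.card F) = π ^ (3 * N) := by
    rw [hcard, Nat.cast_pow, map_pow,
      v.map_prime_eq_map_one_sub_pow hpp (isPrimitiveRoot_zetaC p), ← pow_mul]
    congr 1
    have : p - 1 = 3 * c := by omega
    rw [this, hN]
    ring
  have hcop (k : ℕ) (hk : k.Prime) (hkp : k ≠ p) : v (k : ℂ) = 1 :=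
    v.natCast_eq_one_of_coprime hvp ((Nat.coprime_primes hk hpp).mpr hkp)
  have hv3 : v 3 = 1 := by exact_mod_cast hcop 3 Nat.prime_three (by omega)
  have hv2 : v 2 = 1 := by exact_mod_cast hcop 2 Nat.prime_two (by omega)
  have hW (a : F) : v (weilSum p F (m + 1) a) = v (3 * weilSum p F (m + 1) a) := by
    rw [map_mul, hv3, one_mul]
  -- In `3 W(a)` the terms with `q` and `χ ^ (2 * m)` are negligible against `π ^ N`.
  have hlt {k : ℕ} (hk : 1 < k) : π ^ (k * N) < π ^ N :=
    pow_lt_pow_right_of_lt_one₀ hπ0 hπ1 (lt_mul_of_one_lt_left hNpos hk)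
  have hle (a : F) : v (weilSum p F (m + 1) a) ≤ π ^ N := by
    rw [hW, three_mul_weilSum p hm hinj]
    refine v.map_add_le (v.map_add_le ?_ ?_) ?_
    · split_ifs
      · rw [hq]
        exact (hlt (by norm_num)).le
      · simp
    · rw [← h1]
      simpa using valuation_sum_nthRoots_gaussSum_le p v hθ1 χ 1 a
    · refine (valuation_sum_nthRoots_gaussSum_le p v hθ2 χ 2 a).trans ?_
      rw [h2]
      exact (hlt (by norm_num)).le
  have heq : v (weilSum p F (m + 1) 1) = π ^ N := by
    have h := valuation_sum_nthRoots_gaussSum_one p hv2 hm χ hθ1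
    rw [h1] at h
    have h' := (valuation_sum_nthRoots_gaussSum_le p v hθ2 χ 2 1).trans_eq h2
    rw [hW, three_mul_weilSum p hm hinj, if_pos (one_pow 3), add_assoc,
      v.map_add_eq_of_lt_right, v.map_add_eq_of_lt_left, h]
    · rw [h]
      exact h'.trans_lt (hlt (by norm_num))
    · rw [v.map_add_eq_of_lt_left, h, hq]
      · exact hlt (by norm_num)
      · rw [h]
        exact h'.trans_lt (hlt (by norm_num))
  have hfrac : ((n : ℚ) / 3 : ℚ) = N / ((p : ℚ) - 1) := by
    have : (c : ℚ) ≠ 0 := by positivity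
    rw [hN, hp]
    push_cast
    field_simp
    ring
  rw [hfrac, minVal]
  refine le_antisymm ((Finset.inf'_le _ (Finset.mem_univ (1 : F))).trans_eq ?_)
    (Finset.le_inf' _ _ fun a _ => ?_)
  · exact val_eq_of_map_eq p hvp heq
  · exact le_val_of_map_le p hvp (hle a)

end WeilSumValuation

/-! ### The arithmetic of the exponent -/

theorem modEq_one_iff_three_dvd {p q n d : ℕ} (hp1 : 1 < p) (hp : p ≡ 1 [MOD 3]) (hn : q = p ^ n)
    (hd : 3 * d = q + 2) : d ≡ 1 [MOD (p - 1)] ↔ 3 ∣ n := by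
  obtain ⟨k, rfl⟩ : ∃ k, p = k + 1 := ⟨p - 1, by omega⟩
  have hg := geom_sum_mul_add k n
  set S := ∑ i ∈ Finset.range n, (k + 1) ^ i with hS
  have hSn : S ≡ n [MOD 3] := by
    have h (i : ℕ) : (k + 1) ^ i ≡ 1 [MOD 3] := by simpa using hp.pow i
    simpa using Nat.ModEq.sum (s := Finset.range n) (g := fun _ => 1) fun i _ => h i
  have hk : 0 < k := by omega
  have hd1 : 3 * (d - 1) = k * S := by
    have : 0 < d := by omega
    rw [mul_comm k]
    omega
  have hSd : 3 ∣ S ↔ 3 ∣ n := hSn.dvd_iff dvd_rfl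
  rw [← hSd, Nat.add_sub_cancel, Nat.ModEq.comm, Nat.modEq_iff_dvd' (by omega)]
  rw [← Nat.mul_dvd_mul_iff_left (show 0 < 3 by norm_num), hd1, mul_comm 3 k,
    Nat.mul_dvd_mul_iff_left hk]

theorem gcd_eq_one_iff_mod_nine {q d : ℕ} (hq : q % 3 = 1) (hd : 3 * d = q + 2) :
    Nat.gcd d (q - 1) = 1 ↔ q % 9 = 1 ∨ q % 9 = 4 := by
  have h3 : Nat.gcd d (q - 1) = Nat.gcd d 3 := by
    rw [show q - 1 = d * 3 - 3 by omega]
    exact Nat.gcd_mul_left_sub_right (by omega)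
  rw [h3]
  change Nat.Coprime d 3 ↔ _
  rw [Nat.coprime_comm, Nat.Prime.coprime_iff_not_dvd Nat.prime_three]
  omega

end WeilSum

theorem lemma5p6 (p : ℕ) [Fact p.Prime] (hp : p ≡ 1 [MOD 3])
    (F : Type*) [Field F] [Fintype F] [Algebra (ZMod p) F]
    (q n d : ℕ) (hq : q = Fintype.card F) (hn : q = p ^ n) (hd : 3 * d = q + 2) :
    (d ≡ 1 [MOD (p - 1)] ↔ 3 ∣ n) ∧
    (Nat.gcd d (q - 1) = 1 ↔ q % 9 = 1 ∨ q % 9 = 4) ∧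
    (Nat.gcd d (q - 1) = 1 → WeilSum.minVal p F d = (((n : ℚ) / 3 : ℚ) : WithTop ℚ)) := by
  have hp1 : 1 < p := (Fact.out : p.Prime).one_lt
  refine ⟨WeilSum.modEq_one_iff_three_dvd hp1 hp hn hd,
    WeilSum.gcd_eq_one_iff_mod_nine (by omega) hd, fun _ => ?_⟩
  obtain ⟨m, rfl⟩ : ∃ m, d = m + 1 := ⟨d - 1, by omega⟩
  have hp3 : p % 3 = 1 := hp
  exact WeilSum.minVal_eq p F (c := p / 3) (by omega) (hq ▸ hn) (by omega)
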